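/- **Theorem 1.** All graphs are simple and may be finite or infinite. Let $G$ be a connected graph. An *end* of $G$ is an equivalence class of rays (one-way infinite paths), where two rays are equivalent if for every finite vertex set $S$ they have tails in the same component of $G-S$; write $\hat V(G)=V(G)\cup\Omega(G)$ for the set of all vertices and ends of $G$. A set $X\subseteq\hat V(G)$ *lives in* a subgraph $C\subseteq G$ if all vertices of $X$ lie in $C$ and all rays of ends in $X$ have tails in $C$. An edge set $F\subseteq E(G)$ *distinguishes* $X,Y\subseteq\hat V(G)$ if $X$ and $Y$ live in distinct components of $G-F$, and it does so *efficiently* if no edge set of smaller size distinguishes $X$ and $Y$. For $k\in\mathbb N\cup\{\infty\}$, two elements $x,y$ of $\hat V(G)$ are *$(<k)$-inseparable* if no set of fewer than $k$ edges distinguishes $\{x\}$ and $\{y\}$ (for $k=\infty$: no finite set of edges); this is an equivalence relation on $\hat V(G)$, and its classes are the *$k$-edge-blocks* of $G$. An *edge-block* is a $k$-edge-block for some $k\in\mathbb N\cup\{\infty\}$. A *cut* of $G$ is the set of all edges between $A$ and $V(G)\setminus A$, the *sides* of the cut, both of which are required to be non-empty; a *bond* is a cut whose sides both induce connected subgraphs.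 Two cuts are *nested* if some side of one is included in some side of the other. Then to every connected graph $G$ one can assign a set $N(G)$ of bonds of $G$ such that 1. every two bonds in $N(G)$ are nested; 2. every two disjoint edge-blocks of $G$ (not necessarily $k$-edge-blocks for the same $k$) are efficiently distinguished by some bond in $N(G)$; 3. the assignment is canonical: if $\varphi\colon G\to G'$ is an isomorphism of connected graphs, then $N(G')=\varphi(N(G))=\{\varphi(F) : F\in N(G)\}$. -/

import Mathlib

universe u

namespace SimpleGraph

variable {V : Type u}

/-- A ray of `G`: a one-way infinite path, given by its sequence of (distinct) vertices. -/
structure Ray (G : SimpleGraph V) where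
  vert : ℕ → V
  injective : Function.Injective vert
  adj : ∀ n, G.Adj (vert n) (vert (n + 1))

namespace Ray

variable {G : SimpleGraph V}

/-- Some tail of the ray `R` is contained in the component `C` of the subgraph `H` of `G`
(both its vertices and its edges lie in `C`). -/
def HasTailIn (R : G.Ray) {H : SimpleGraph V} (C : H.ConnectedComponent) : Prop :=
  ∃ n, ∀ m, n ≤ m → R.vert m ∈ C.supp ∧ H.Adj (R.vert m) (R.vert (m + 1))

/-- Some tail of the ray `R` is contained in the component `C` of `G - S`; here `S` is a vertex
set, so `C` is an induced subgraph and it suffices to look at vertices. -/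
def HasTailAvoiding (R : G.Ray) {S : Set V} (C : G.ComponentCompl S) : Prop :=
  ∃ n, ∀ m, n ≤ m → R.vert m ∈ C

/-- Two rays are equivalent if for every finite vertex set `S` they have tails in the same
component of `G - S`. -/
def Equivalent (R R' : G.Ray) : Prop :=
  ∀ S : Set V, S.Finite → ∃ C : G.ComponentCompl S, R.HasTailAvoiding C ∧ R'.HasTailAvoiding C

theorem exists_hasTailAvoiding (R : G.Ray) {S : Set V} (hS : S.Finite) :
    ∃ C : G.ComponentCompl S, R.HasTailAvoiding C := by
  have hfin : (R.vert ⁻¹' S).Finite := hS.preimage R.injective.injOn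
  obtain ⟨b, hb⟩ := hfin.bddAbove
  have hout : ∀ m, b + 1 ≤ m → R.vert m ∉ S := fun m hm hmem => by
    have := hb (show m ∈ R.vert ⁻¹' S from hmem)
    omega
  refine ⟨G.componentComplMk (hout (b + 1) le_rfl), b + 1, fun m hm => ?_⟩
  induction m, hm using Nat.le_induction with
  | base => exact G.componentComplMk_mem _
  | succ m hm ih => exact ComponentCompl.mem_of_adj _ _ ih (hout (m + 1) (by omega)) (R.adj m)

theorem HasTailAvoiding.unique {R : G.Ray} {S : Set V} {C D : G.ComponentCompl S}
    (hC : R.HasTailAvoiding C) (hD : R.HasTailAvoiding D) : C = D := by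
  obtain ⟨n, hn⟩ := hC
  obtain ⟨m, hm⟩ := hD
  by_contra hne
  exact Set.disjoint_left.1 (ComponentCompl.pairwise_disjoint hne)
    (hn (max n m) (le_max_left _ _)) (hm (max n m) (le_max_right _ _))

/-- Equivalence of rays, as a setoid. -/
instance setoid (G : SimpleGraph V) : Setoid G.Ray where
  r := Equivalent
  iseqv :=
    { refl := fun R _ hS => (R.exists_hasTailAvoiding hS).imp fun _ h => ⟨h, h⟩
      symm := fun h S hS => (h S hS).imp fun _ hC => hC.symm
      trans := fun h h' S hS => by
        obtain ⟨C, h₁, h₂⟩ := h S hS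
        obtain ⟨D, h₃, h₄⟩ := h' S hS
        obtain rfl := h₂.unique h₃
        exact ⟨C, h₁, h₄⟩ }

end Ray

/-- The (vertex-)ends of `G`: the equivalence classes of rays. -/
def RayEnd (G : SimpleGraph V) : Type u :=
  Quotient (Ray.setoid G)

/-- The set `V(G) ∪ Ω(G)` of all vertices and ends of `G`. -/
abbrev Point (G : SimpleGraph V) : Type u :=
  V ⊕ G.RayEnd

variable (G : SimpleGraph V)

/-- The set `X` of vertices and ends of `G` lives in the component `C` of the subgraph `H` of `G`:
all vertices of `X` lie in `C`, and all rays of ends in `X` have tails in `C`. -/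
def LivesIn (X : Set G.Point) {H : SimpleGraph V} (C : H.ConnectedComponent) : Prop :=
  (∀ v : V, Sum.inl v ∈ X → v ∈ C.supp) ∧
    ∀ R : G.Ray, Sum.inr (Quotient.mk (Ray.setoid G) R) ∈ X → R.HasTailIn C

/-- The edge set `F` distinguishes `X` and `Y`: they live in distinct components of `G - F`. -/
def Distinguishes (F : Set (Sym2 V)) (X Y : Set G.Point) : Prop :=
  F ⊆ G.edgeSet ∧
    ∃ C D : (G.deleteEdges F).ConnectedComponent, C ≠ D ∧ G.LivesIn X C ∧ G.LivesIn Y D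

/-- `F` distinguishes `X` and `Y`, and no edge set of smaller size does. -/
def EfficientlyDistinguishes (F : Set (Sym2 V)) (X Y : Set G.Point) : Prop :=
  G.Distinguishes F X Y ∧ ∀ F' : Set (Sym2 V), G.Distinguishes F' X Y → F.encard ≤ F'.encard

/-- Two vertices or ends are `(<k)`-inseparable if no set of fewer than `k` edges separates them;
for `k = ⊤` this means that no finite set of edges does. -/
def Inseparable (k : ℕ∞) (x y : G.Point) : Prop :=
  ¬ ∃ F : Set (Sym2 V), F.encard < k ∧ G.Distinguishes F {x} {y}

/-- The `k`-edge-blocks: the classes of `(<k)`-inseparability. -/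
def IsKEdgeBlock (k : ℕ∞) (X : Set G.Point) : Prop :=
  ∃ x : G.Point, X = {y | G.Inseparable k x y}

/-- An edge-block is a `k`-edge-block for some `k ∈ ℕ ∪ {∞}`. -/
def IsEdgeBlock (X : Set G.Point) : Prop :=
  ∃ k : ℕ∞, G.IsKEdgeBlock k X

/-- The set `E(A, V ∖ A)` of edges between `A` and its complement. -/
def cutEdges (A : Set V) : Set (Sym2 V) :=
  {e | ∃ a ∈ A, ∃ b ∈ Aᶜ, G.Adj a b ∧ e = s(a, b)}

/-- `A` is a side of the cut `F`: `F = E(A, V ∖ A)`, where both `A` and `V ∖ A` are non-empty. -/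
def IsSide (F : Set (Sym2 V)) (A : Set V) : Prop :=
  A.Nonempty ∧ Aᶜ.Nonempty ∧ F = G.cutEdges A

/-- A bond: a cut both of whose sides are connected. -/
def IsBond (F : Set (Sym2 V)) : Prop :=
  ∃ A : Set V, G.IsSide F A ∧ (G.induce A).Connected ∧ (G.induce Aᶜ).Connected

/-- Two cuts are nested if some side of the first is included in some side of the second. -/
def NestedCuts (F₁ F₂ : Set (Sym2 V)) : Prop :=
  ∃ V₁ V₂ : Set V, G.IsSide F₁ V₁ ∧ G.IsSide F₂ V₂ ∧ V₁ ⊆ V₂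

end SimpleGraph

/-! ### Nested sets of minimum separators

`d : Set V → ℕ∞` is a symmetric submodular function on the subsets of `V`; ultrafilters on `V` play
the role of the points to be separated. -/

/-! The size of the cut with side `A` is a symmetric submodular function of `A`. Each vertex or end
yields an ultrafilter on the vertex set; for an end it contains the tails of one of its rays. A
finite cut does not split an end, so a cut of least finite size among those separating the
ultrafilters of two points efficiently distinguishes the points. In a connected graph such a minimum
separator is a bond, since a disconnected side would contain the side of a smaller separator.

Minimum separators are uncrossed by submodularity: opposite corners that separate the relevant pairs
are again minimum. If two crossing separators differ in size, the larger can be replaced by a corner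
nested with the smaller (`exists_corner_of_lt`). If they have equal size, one of them can be
replaced by a corner that crosses fewer minimum separators of that size (`exists_corner_of_eq`).
These crossing numbers are finite: a bond crossing a finite bond `F` separates two endpoints of
edges of `F`, and only finitely many bonds of bounded size separate two given vertices
(`bondSides_finite`).

Hence one may proceed by increasing size and keep, for every pair of ultrafilters, all minimum
separators that are nested with the earlier ones and have least crossing number. The result is
nested and still serves every pair. It is canonical because all optima for all pairs of ultrafilters
are kept; the arbitrary choice of an ultrafilter for an end enters only the verification. -/

namespace MinSeparator

open Set

variable {V : Type u}

/-- Some side of the bipartition `{A, Aᶜ}` is included in some side of `{B, Bᶜ}`. -/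
def Nested (A B : Set V) : Prop :=
  A ⊆ B ∨ A ⊆ Bᶜ ∨ Aᶜ ⊆ B ∨ Aᶜ ⊆ Bᶜ

theorem Nested.symm {A B : Set V} (h : Nested A B) : Nested B A := by
  unfold Nested at *
  rcases h with h | h | h | h
  · exact Or.inr (Or.inr (Or.inr (compl_subset_compl.2 h)))
  · exact Or.inr (Or.inl (subset_compl_comm.1 h))
  · exact Or.inr (Or.inr (Or.inl (compl_subset_comm.1 h)))
  · exact Or.inl (compl_subset_compl.1 h)

theorem nested_compl_right {A B : Set V} : Nested A Bᶜ ↔ Nested A B := by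
  unfold Nested
  rw [compl_compl]
  tauto

theorem nested_compl_left {A B : Set V} : Nested Aᶜ B ↔ Nested A B := by
  unfold Nested
  rw [compl_compl]
  tauto

theorem nested_inter_left (A B : Set V) : Nested A (A ∩ B) :=
  Nested.symm (Or.inl inter_subset_left)

theorem nested_union_left (A B : Set V) : Nested A (A ∪ B) :=
  Or.inl subset_union_left

/-- A set nested with two crossing sets is nested with their intersection. -/
theorem Nested.inter {A B X : Set V} (hAB : ¬ Nested A B) (hA : Nested X A) (hB : Nested X B) :
    Nested X (A ∩ B) := by
  -- The only configurations that could fail: they give `Aᶜ ⊆ Yᶜ ⊆ B`, so `A` and `B` would not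
  -- cross.
  have key : ∀ Y : Set V, Y ⊆ A → Yᶜ ⊆ B → False := fun Y h₁ h₂ =>
    hAB (Or.inr (Or.inr (Or.inl ((compl_subset_compl.2 h₁).trans h₂))))
  unfold Nested at hA hB ⊢
  rcases hA with hA | hA | hA | hA
  · rcases hB with hB | hB | hB | hB
    · exact Or.inl (subset_inter hA hB)
    · exact Or.inr (Or.inl (hB.trans (compl_subset_compl.2 inter_subset_right)))
    · exact (key X hA hB).elim
    · exact Or.inr (Or.inr (Or.inr (hB.trans (compl_subset_compl.2 inter_subset_right))))
  · exact Or.inr (Or.inl (hA.trans (compl_subset_compl.2 inter_subset_left)))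
  · rcases hB with hB | hB | hB | hB
    · exact (key Xᶜ hA (by rwa [compl_compl])).elim
    · exact Or.inr (Or.inl (hB.trans (compl_subset_compl.2 inter_subset_right)))
    · exact Or.inr (Or.inr (Or.inl (subset_inter hA hB)))
    · exact Or.inr (Or.inr (Or.inr (hB.trans (compl_subset_compl.2 inter_subset_right))))
  · exact Or.inr (Or.inr (Or.inr (hA.trans (compl_subset_compl.2 inter_subset_left))))

/-- A set nested with two crossing sets is nested with their union. -/
theorem Nested.union {A B X : Set V} (hAB : ¬ Nested A B) (hA : Nested X A) (hB : Nested X B) :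
    Nested X (A ∪ B) := by
  have h := Nested.inter (A := Aᶜ) (B := Bᶜ) (X := X)
    (by rwa [nested_compl_left, nested_compl_right])
    (nested_compl_right.2 hA) (nested_compl_right.2 hB)
  rwa [← compl_union, nested_compl_right] at h

/-- A set nested with `A` is nested with one of any two opposite corners of `A`. -/
theorem Nested.inter_or_union {A X : Set V} (hA : Nested X A) (B : Set V) :
    Nested X (A ∩ B) ∨ Nested X (A ∪ B) := by
  unfold Nested at hA
  rcases hA with hA | hA | hA | hA
  · exact Or.inr (Or.inl (hA.trans subset_union_left))
  · exact Or.inl (Or.inr (Or.inl (hA.trans (compl_subset_compl.2 inter_subset_left))))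
  · exact Or.inr (Or.inr (Or.inr (Or.inl (hA.trans subset_union_left))))
  · exact Or.inl (Or.inr (Or.inr (Or.inr (hA.trans (compl_subset_compl.2 inter_subset_left)))))

/-! ### Minimum separators of ultrafilters -/

theorem inter_mem_ultrafilter {A B : Set V} {p : Ultrafilter V} :
    A ∩ B ∈ p ↔ A ∈ p ∧ B ∈ p :=
  Filter.inter_mem_iff (f := (p : Filter V))

/-- Exactly one of the two ultrafilters contains `A`. -/
def Sep (A : Set V) (p q : Ultrafilter V) : Prop := ¬ (A ∈ p ↔ A ∈ q)

/-- The sets of value `k` that separate `p` from `q`, provided that no set of smaller value does. -/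
def minSeparators (d : Set V → ℕ∞) (k : ℕ) (p q : Ultrafilter V) : Set (Set V) :=
  {A | Sep A p q ∧ d A = k ∧ ∀ B, Sep B p q → (k : ℕ∞) ≤ d B}

/-- All minimum separators of value `k`. -/
def allMinSeparators (d : Set V → ℕ∞) (k : ℕ) : Set (Set V) :=
  {A | ∃ p q, A ∈ minSeparators d k p q}

/-- The minimum separators of value `k` that cross `A`. -/
def crossing (d : Set V → ℕ∞) (k : ℕ) (A : Set V) : Set (Set V) :=
  {B | B ∈ allMinSeparators d k ∧ ¬ Nested A B}

/-- The minimum separators of `p` and `q` that are nested with all elements of `S`. -/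
def admissible (d : Set V → ℕ∞) (k : ℕ) (S : Set (Set V)) (p q : Ultrafilter V) : Set (Set V) :=
  {A | A ∈ minSeparators d k p q ∧ ∀ B ∈ S, Nested A B}

/-- The admissible minimum separators that cross as few minimum separators of the same value as
possible. -/
def optimal (d : Set V → ℕ∞) (k : ℕ) (S : Set (Set V)) : Set (Set V) :=
  {A | ∃ p q, A ∈ admissible d k S p q ∧
    ∀ B ∈ admissible d k S p q, (crossing d k A).ncard ≤ (crossing d k B).ncard}

/-- The optimal separators of value less than `k`, chosen recursively. -/
def nestedBelow (d : Set V → ℕ∞) : ℕ → Set (Set V)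
  | 0 => ∅
  | k + 1 => nestedBelow d k ∪ optimal d k (nestedBelow d k)

/-- The nested set of minimum separators associated with `d`. -/
def nestedSet (d : Set V → ℕ∞) : Set (Set V) := ⋃ k, nestedBelow d k

theorem minSeparators_compl {d : Set V → ℕ∞} (hd : ∀ A, d Aᶜ = d A) {k : ℕ} {p q : Ultrafilter V}
    {A : Set V} (hA : A ∈ minSeparators d k p q) : Aᶜ ∈ minSeparators d k p q := by
  refine ⟨?_, by rw [hd, hA.2.1], hA.2.2⟩
  have := hA.1
  unfold Sep at this ⊢
  rw [Ultrafilter.compl_mem_iff_notMem, Ultrafilter.compl_mem_iff_notMem]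
  tauto

theorem allMinSeparators_compl {d : Set V → ℕ∞} (hd : ∀ A, d Aᶜ = d A) {k : ℕ} {A : Set V}
    (hA : A ∈ allMinSeparators d k) : Aᶜ ∈ allMinSeparators d k := by
  obtain ⟨p, q, h⟩ := hA
  exact ⟨p, q, minSeparators_compl hd h⟩

theorem crossing_compl (d : Set V → ℕ∞) (k : ℕ) (A : Set V) :
    crossing d k Aᶜ = crossing d k A := by
  unfold crossing
  simp only [nested_compl_left]

/-! ### Uncrossing two minimum separators -/

section Submodular

variable {d : Set V → ℕ∞}

/-- If the corner opposite to `C` separates `p` from `q` while `C` separates `u` from `v`, then `C`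
is a minimum separator of `u` and `v`. -/
theorem corner_mem_minSeparators {j k : ℕ} {p q u v : Ultrafilter V} {A B C C' : Set V}
    (hsub : d C + d C' ≤ d A + d B) (hA : A ∈ minSeparators d j p q)
    (hB : B ∈ minSeparators d k u v) (hC : Sep C u v) (hC' : Sep C' p q) :
    C ∈ minSeparators d k u v := by
  refine ⟨hC, le_antisymm ?_ (hB.2.2 C hC), hB.2.2⟩
  -- The opposite corner costs at least `j`, so submodularity leaves at most `k` for `C`; cancelling
  -- `j` is legitimate because it is finite.
  have h₁ : d C + j ≤ (k : ℕ∞) + j := by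
    calc d C + j ≤ d C + d C' := add_le_add le_rfl (hA.2.2 C' hC')
      _ ≤ d A + d B := hsub
      _ = (k : ℕ∞) + j := by rw [hA.2.1, hB.2.1, add_comm]
  exact (ENat.add_le_add_iff_right (ENat.natCast_ne_top j)).1 h₁

variable (hcompl : ∀ A, d Aᶜ = d A) (hsub : ∀ A B, d (A ∩ B) + d (A ∪ B) ≤ d A + d B)

include hcompl hsub in
/-- A minimum separator of `u` and `v` that crosses a minimum separator `A` of smaller value can be
replaced by one of their corners. -/
theorem exists_corner_of_lt {j k : ℕ} (hjk : j < k) {p q u v : Ultrafilter V} {A B : Set V}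
    (hA : A ∈ minSeparators d j p q) (hB : B ∈ minSeparators d k u v) (hAB : ¬ Nested A B) :
    ∃ C ∈ minSeparators d k u v, Nested A C ∧
      ∀ X, Nested X A → Nested X B → Nested X C := by
  have hAuv : ¬ Sep A u v := fun h => by
    have := hB.2.2 A h
    rw [hA.2.1] at this
    exact absurd (Nat.cast_le.1 this) (by omega)
  have hABc : ¬ Nested A Bᶜ := by rwa [nested_compl_right]
  have hBc := minSeparators_compl hcompl hB
  -- Since `u` and `v` share a side of `A`, both corners on that side separate them. One of `p`, `q`
  -- is on the other side of `A`, in a corner opposite to one of these two.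
  have cases : (Sep (A ∩ B) u v ∧ Sep (A ∪ B) p q) ∨ (Sep (A ∪ B) u v ∧ Sep (A ∩ B) p q) ∨
      (Sep (A ∩ Bᶜ) u v ∧ Sep (A ∪ Bᶜ) p q) ∨ (Sep (A ∪ Bᶜ) u v ∧ Sep (A ∩ Bᶜ) p q) := by
    have h₁ := hA.1
    have h₂ := hB.1
    clear * - h₁ h₂ hAuv
    simp only [Sep, inter_mem_ultrafilter, Ultrafilter.union_mem_iff,
      Ultrafilter.compl_mem_iff_notMem] at *
    grind
  rcases cases with h | h | h | h
  · exact ⟨_, corner_mem_minSeparators (hsub A B) hA hB h.1 h.2, nested_inter_left _ _,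
      fun X h₁ h₂ => Nested.inter hAB h₁ h₂⟩
  · exact ⟨_, corner_mem_minSeparators ((add_comm _ _).trans_le (hsub A B)) hA hB h.1 h.2,
      nested_union_left _ _, fun X h₁ h₂ => Nested.union hAB h₁ h₂⟩
  · exact ⟨_, corner_mem_minSeparators (hsub A Bᶜ) hA hBc h.1 h.2, nested_inter_left _ _,
      fun X h₁ h₂ => Nested.inter hABc h₁ (nested_compl_right.2 h₂)⟩
  · exact ⟨_, corner_mem_minSeparators ((add_comm _ _).trans_le (hsub A Bᶜ)) hA hBc h.1 h.2,
      nested_union_left _ _, fun X h₁ h₂ => Nested.union hABc h₁ (nested_compl_right.2 h₂)⟩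

/-- The crossing number is strictly submodular on crossing minimum separators. -/
theorem ncard_crossing_lt {k : ℕ} {A B : Set V} (hA : A ∈ allMinSeparators d k)
    (hAB : ¬ Nested A B) (hfA : (crossing d k A).Finite) (hfB : (crossing d k B).Finite) :
    (crossing d k (A ∩ B)).ncard + (crossing d k (A ∪ B)).ncard <
      (crossing d k A).ncard + (crossing d k B).ncard := by
  -- Whatever is nested with `A` and `B` is nested with both corners. The inclusion is strict
  -- because `A` crosses `B` but neither corner.
  have hsubU : crossing d k (A ∩ B) ∪ crossing d k (A ∪ B) ⊂ crossing d k A ∪ crossing d k B := by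
    refine ⟨?_, fun h => ?_⟩
    · rintro X (⟨hX, hn⟩ | ⟨hX, hn⟩)
      · by_contra hc
        simp only [crossing, mem_union, mem_ofPred_eq, hX, true_and, not_or, not_not] at hc
        exact hn (Nested.inter hAB hc.1.symm hc.2.symm).symm
      · by_contra hc
        simp only [crossing, mem_union, mem_ofPred_eq, hX, true_and, not_or, not_not] at hc
        exact hn (Nested.union hAB hc.1.symm hc.2.symm).symm
    · rcases h (Or.inr ⟨hA, fun hn => hAB hn.symm⟩ : A ∈ crossing d k A ∪ crossing d k B)
        with h | h
      · exact h.2 (nested_inter_left A B).symm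
      · exact h.2 (nested_union_left A B).symm
  have hsubI : crossing d k (A ∩ B) ∩ crossing d k (A ∪ B) ⊆ crossing d k A ∩ crossing d k B := by
    rintro X ⟨⟨hX, h₁⟩, -, h₂⟩
    refine ⟨⟨hX, fun hn => ?_⟩, hX, fun hn => ?_⟩
    · rcases hn.symm.inter_or_union B with h | h
      · exact h₁ h.symm
      · exact h₂ h.symm
    · rcases hn.symm.inter_or_union A with h | h
      · exact h₁ (inter_comm B A ▸ h.symm)
      · exact h₂ (union_comm B A ▸ h.symm)
  have hfU := hfA.union hfB
  have hf₁ : (crossing d k (A ∩ B)).Finite := hfU.subset (subset_union_left.trans hsubU.1)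
  have hf₂ : (crossing d k (A ∪ B)).Finite := hfU.subset (subset_union_right.trans hsubU.1)
  rw [← ncard_union_add_ncard_inter _ _ hf₁ hf₂, ← ncard_union_add_ncard_inter _ _ hfA hfB]
  exact add_lt_add_of_lt_of_le (ncard_lt_ncard hsubU hfU)
    (ncard_le_ncard hsubI (hfA.inter_of_left _))

include hcompl hsub in
/-- Of two crossing minimum separators of the same value, one can be replaced by a corner with
smaller crossing number. -/
theorem exists_corner_of_eq {k : ℕ} {p q u v : Ultrafilter V} {A B : Set V}
    (hA : A ∈ minSeparators d k p q) (hB : B ∈ minSeparators d k u v) (hAB : ¬ Nested A B)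
    (hfA : (crossing d k A).Finite) (hfB : (crossing d k B).Finite) :
    (∃ C ∈ minSeparators d k p q, (∀ X, Nested X A → Nested X B → Nested X C) ∧
        (crossing d k C).ncard < (crossing d k A).ncard) ∨
      ∃ C ∈ minSeparators d k u v, (∀ X, Nested X A → Nested X B → Nested X C) ∧
        (crossing d k C).ncard < (crossing d k B).ncard := by
  have hABc : ¬ Nested A Bᶜ := by rwa [nested_compl_right]
  have hBc := minSeparators_compl hcompl hB
  have hlt := ncard_crossing_lt ⟨p, q, hA⟩ hAB hfA hfB
  have hltc := ncard_crossing_lt ⟨p, q, hA⟩ hABc hfA (by rwa [crossing_compl])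
  rw [crossing_compl] at hltc
  have hsub' : ∀ A B, d (A ∪ B) + d (A ∩ B) ≤ d A + d B :=
    fun A B => (add_comm _ _).trans_le (hsub A B)
  have hI : ∀ X, Nested X A → Nested X B → Nested X (A ∩ B) := fun X => Nested.inter hAB
  have hU : ∀ X, Nested X A → Nested X B → Nested X (A ∪ B) := fun X => Nested.union hAB
  have hIc : ∀ X, Nested X A → Nested X B → Nested X (A ∩ Bᶜ) :=
    fun X h₁ h₂ => Nested.inter hABc h₁ (nested_compl_right.2 h₂)
  have hUc : ∀ X, Nested X A → Nested X B → Nested X (A ∪ Bᶜ) :=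
    fun X h₁ h₂ => Nested.union hABc h₁ (nested_compl_right.2 h₂)
  -- two opposite corners, one separating `p, q` and the other separating `u, v`
  have mixed : ∀ B' C C', B' ∈ minSeparators d k u v → d C + d C' ≤ d A + d B' →
      d C' + d C ≤ d B' + d A →
      (∀ X, Nested X A → Nested X B → Nested X C) → (∀ X, Nested X A → Nested X B → Nested X C') →
      (crossing d k C).ncard + (crossing d k C').ncard <
        (crossing d k A).ncard + (crossing d k B).ncard → Sep C u v → Sep C' p q →
      (∃ C ∈ minSeparators d k p q, (∀ X, Nested X A → Nested X B → Nested X C) ∧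
        (crossing d k C).ncard < (crossing d k A).ncard) ∨
      ∃ C ∈ minSeparators d k u v, (∀ X, Nested X A → Nested X B → Nested X C) ∧
        (crossing d k C).ncard < (crossing d k B).ncard := by
    intro B' C C' hB' h₁ h₂ hC hC' hlt hs hs'
    -- The sum of the crossing numbers drops, so at least one corner improves on the separator it
    -- replaces.
    rcases lt_or_ge (crossing d k C').ncard (crossing d k A).ncard with h | h
    · exact Or.inl ⟨C', corner_mem_minSeparators h₂ hB' hA hs' hs, hC', h⟩
    · exact Or.inr ⟨C, corner_mem_minSeparators h₁ hA hB' hs hs', hC, by omega⟩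
  have m₁ := mixed B (A ∩ B) (A ∪ B) hB (hsub A B) ((hsub' A B).trans_eq (add_comm _ _)) hI hU hlt
  have m₂ := mixed B (A ∪ B) (A ∩ B) hB (hsub' A B) ((hsub A B).trans_eq (add_comm _ _)) hU hI
    (by omega)
  have m₃ := mixed Bᶜ (A ∩ Bᶜ) (A ∪ Bᶜ) hBc (hsub A Bᶜ) ((hsub' A Bᶜ).trans_eq (add_comm _ _))
    hIc hUc hltc
  have m₄ := mixed Bᶜ (A ∪ Bᶜ) (A ∩ Bᶜ) hBc (hsub' A Bᶜ) ((hsub A Bᶜ).trans_eq (add_comm _ _))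
    hUc hIc (by omega)
  -- all four corners separate, opposite corners separating the same pair
  have allFour : ∀ B' C C' D D', B' ∈ minSeparators d k u v → Sep B' p q → Sep A u v →
      d C + d C' ≤ d B' + d A → d C' + d C ≤ d B' + d A →
      d D + d D' ≤ d A + d B' → d D' + d D ≤ d A + d B' →
      (∀ X, Nested X A → Nested X B → Nested X C) → (∀ X, Nested X A → Nested X B → Nested X C') →
      (∀ X, Nested X A → Nested X B → Nested X D) → (∀ X, Nested X A → Nested X B → Nested X D') →
      (crossing d k C).ncard + (crossing d k C').ncard <
        (crossing d k A).ncard + (crossing d k B).ncard →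
      (crossing d k D).ncard + (crossing d k D').ncard <
        (crossing d k A).ncard + (crossing d k B).ncard →
      Sep C p q → Sep C' p q → Sep D u v → Sep D' u v →
      (∃ C ∈ minSeparators d k p q, (∀ X, Nested X A → Nested X B → Nested X C) ∧
        (crossing d k C).ncard < (crossing d k A).ncard) ∨
      ∃ C ∈ minSeparators d k u v, (∀ X, Nested X A → Nested X B → Nested X C) ∧
        (crossing d k C).ncard < (crossing d k B).ncard := by
    intro B' C C' D D' hB' hBpq hAuv h₁ h₂ h₃ h₄ hC hC' hD hD' hlt₁ hlt₂ sC sC' sD sD'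
    -- As the values agree, each of `A` and `B'` is a minimum separator of both pairs.
    have hB'pq : B' ∈ minSeparators d k p q := ⟨hBpq, hB'.2.1, hA.2.2⟩
    have hA'uv : A ∈ minSeparators d k u v := ⟨hAuv, hA.2.1, hB.2.2⟩
    -- Replace the one with the larger crossing number: the two corners serving its pair have
    -- crossing numbers summing to less than twice that maximum.
    rcases le_total (crossing d k B).ncard (crossing d k A).ncard with h | h
    · rcases lt_or_ge (crossing d k C).ncard (crossing d k A).ncard with h' | h'
      · exact Or.inl ⟨C, corner_mem_minSeparators h₁ hB'pq hA sC sC', hC, h'⟩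
      · exact Or.inl ⟨C', corner_mem_minSeparators h₂ hB'pq hA sC' sC, hC', by omega⟩
    · rcases lt_or_ge (crossing d k D).ncard (crossing d k B).ncard with h' | h'
      · exact Or.inr ⟨D, corner_mem_minSeparators h₃ hA'uv hB' sD sD', hD, h'⟩
      · exact Or.inr ⟨D', corner_mem_minSeparators h₄ hA'uv hB' sD' sD, hD', by omega⟩
  have f₁ := allFour B (A ∩ B) (A ∪ B) (A ∩ Bᶜ) (A ∪ Bᶜ) hB
  have f₂ := allFour B (A ∩ Bᶜ) (A ∪ Bᶜ) (A ∩ B) (A ∪ B) hB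
  have e₁ : d B + d A = d A + d B := add_comm _ _
  have hs₁ := hsub A B
  have hs₂ := hsub' A B
  have hs₃ := hsub A Bᶜ
  have hs₄ := hsub' A Bᶜ
  rw [hcompl] at hs₃ hs₄
  rw [e₁] at f₁ f₂
  -- If one set fails to separate the other's pair, two opposite corners do as for unequal values.
  -- Otherwise each pair occupies two opposite corners: the same two for both pairs (again the mixed
  -- case), or different ones (the last case).
  have hcases : (Sep (A ∩ B) u v ∧ Sep (A ∪ B) p q) ∨ (Sep (A ∪ B) u v ∧ Sep (A ∩ B) p q) ∨
      (Sep (A ∩ Bᶜ) u v ∧ Sep (A ∪ Bᶜ) p q) ∨ (Sep (A ∪ Bᶜ) u v ∧ Sep (A ∩ Bᶜ) p q) ∨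
      (Sep B p q ∧ Sep A u v ∧ ((Sep (A ∩ B) p q ∧ Sep (A ∪ B) p q ∧ Sep (A ∩ Bᶜ) u v ∧
          Sep (A ∪ Bᶜ) u v) ∨
        (Sep (A ∩ Bᶜ) p q ∧ Sep (A ∪ Bᶜ) p q ∧ Sep (A ∩ B) u v ∧ Sep (A ∪ B) u v))) := by
    have h₁ := hA.1
    have h₂ := hB.1
    clear * - h₁ h₂
    simp only [Sep, inter_mem_ultrafilter, Ultrafilter.union_mem_iff,
      Ultrafilter.compl_mem_iff_notMem] at *
    by_cases A ∈ p <;> by_cases A ∈ q <;> by_cases A ∈ u <;> by_cases A ∈ v <;>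
      by_cases B ∈ p <;> by_cases B ∈ q <;> by_cases B ∈ u <;> by_cases B ∈ v <;> simp_all
  rcases hcases with h | h | h | h | ⟨sB, sA, h | h⟩
  · exact m₁ h.1 h.2
  · exact m₂ h.1 h.2
  · exact m₃ h.1 h.2
  · exact m₄ h.1 h.2
  · exact f₁ sB sA hs₁ hs₂ hs₃ hs₄ hI hU hIc hUc hlt hltc h.1 h.2.1 h.2.2.1 h.2.2.2
  · exact f₂ sB sA hs₃ hs₄ hs₁ hs₂ hIc hUc hI hU hltc hlt h.1 h.2.1 h.2.2.1 h.2.2.2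

end Submodular

/-! ### The recursive choice of a nested set -/

section NestedSet

variable {d : Set V → ℕ∞}

theorem exists_level_of_mem_nestedBelow {k : ℕ} {A : Set V} (h : A ∈ nestedBelow d k) :
    ∃ j < k, A ∈ optimal d j (nestedBelow d j) := by
  induction k with
  | zero => exact h.elim
  | succ k ih =>
    rcases h with h | h
    · obtain ⟨j, hj, hA⟩ := ih h
      exact ⟨j, by omega, hA⟩
    · exact ⟨k, by omega, h⟩

theorem exists_mem_allMinSeparators_of_mem_nestedBelow {k : ℕ} {A : Set V}
    (h : A ∈ nestedBelow d k) : ∃ j < k, A ∈ allMinSeparators d j := by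
  obtain ⟨j, hj, p, q, hA, -⟩ := exists_level_of_mem_nestedBelow h
  exact ⟨j, hj, p, q, hA.1⟩

theorem exists_mem_allMinSeparators_of_mem_nestedSet {A : Set V} (h : A ∈ nestedSet d) :
    ∃ j, A ∈ allMinSeparators d j := by
  obtain ⟨k, hk⟩ := mem_iUnion.1 h
  obtain ⟨j, -, hj⟩ := exists_mem_allMinSeparators_of_mem_nestedBelow hk
  exact ⟨j, hj⟩

variable (hcompl : ∀ A, d Aᶜ = d A) (hsub : ∀ A B, d (A ∩ B) + d (A ∪ B) ≤ d A + d B)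
  (hfin : ∀ j k A, A ∈ allMinSeparators d j → (crossing d k A).Finite)

-- If two optimal separators crossed, a corner replacing one of them would have smaller crossing
-- number and remain admissible, being nested with everything that both are nested with.
include hcompl hsub hfin in
theorem nested_of_mem_optimal {k : ℕ} {S : Set (Set V)} {A B : Set V}
    (hA : A ∈ optimal d k S) (hB : B ∈ optimal d k S) : Nested A B := by
  by_contra hAB
  obtain ⟨p, q, ⟨hAm, hAS⟩, hAmin⟩ := hA
  obtain ⟨u, v, ⟨hBm, hBS⟩, hBmin⟩ := hB
  rcases exists_corner_of_eq hcompl hsub hAm hBm hAB (hfin k k A ⟨p, q, hAm⟩)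
    (hfin k k B ⟨u, v, hBm⟩) with ⟨C, hC, hCn, hlt⟩ | ⟨C, hC, hCn, hlt⟩
  · exact absurd (hAmin C ⟨hC, fun X hX => (hCn X (hAS X hX).symm (hBS X hX).symm).symm⟩)
      (not_le.2 hlt)
  · exact absurd (hBmin C ⟨hC, fun X hX => (hCn X (hAS X hX).symm (hBS X hX).symm).symm⟩)
      (not_le.2 hlt)

include hcompl hsub hfin in
theorem nested_of_mem_nestedBelow (k : ℕ) :
    ∀ A ∈ nestedBelow d k, ∀ B ∈ nestedBelow d k, Nested A B := by
  induction k with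
  | zero => exact fun A hA => hA.elim
  | succ k ih =>
    rintro A (hA | hA) B (hB | hB)
    · exact ih A hA B hB
    · obtain ⟨p, q, h, -⟩ := hB
      exact (h.2 A hA).symm
    · obtain ⟨p, q, h, -⟩ := hA
      exact h.2 B hB
    · exact nested_of_mem_optimal hcompl hsub hfin hA hB

theorem nestedBelow_mono : Monotone (nestedBelow d) :=
  monotone_nat_of_le_succ fun _ => subset_union_left

include hcompl hsub hfin in
theorem nested_of_mem_nestedSet {A B : Set V} (hA : A ∈ nestedSet d) (hB : B ∈ nestedSet d) :
    Nested A B := by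
  obtain ⟨k, hk⟩ := mem_iUnion.1 hA
  obtain ⟨l, hl⟩ := mem_iUnion.1 hB
  exact nested_of_mem_nestedBelow hcompl hsub hfin (max k l) A
    (nestedBelow_mono (le_max_left k l) hk) B (nestedBelow_mono (le_max_right k l) hl)

-- A minimum separator crossing the fewest earlier choices crosses none: otherwise a corner with a
-- crossed `B` is nested with `B` and, since the earlier choices are nested with `B`, crosses no new
-- one.
include hcompl hsub hfin in
theorem admissible_nonempty {k : ℕ} {p q : Ultrafilter V} (h : (minSeparators d k p q).Nonempty) :
    (admissible d k (nestedBelow d k) p q).Nonempty := by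
  -- Needed for the comparison of `ncard`, which is `0` on infinite sets.
  have hfinite : ∀ A ∈ minSeparators d k p q,
      {B | B ∈ nestedBelow d k ∧ ¬ Nested A B}.Finite := fun A hA => by
    refine ((Set.finite_Iio k).biUnion fun j _ => hfin k j A ⟨p, q, hA⟩).subset ?_
    rintro B ⟨hB, hn⟩
    obtain ⟨j, hj, hBj⟩ := exists_mem_allMinSeparators_of_mem_nestedBelow hB
    exact mem_biUnion (show j ∈ Iio k from hj) ⟨hBj, hn⟩
  obtain ⟨A, hA, hmin⟩ := exists_minimalFor_of_wellFoundedLT (· ∈ minSeparators d k p q)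
    (fun A => {B | B ∈ nestedBelow d k ∧ ¬ Nested A B}.ncard) h
  refine ⟨A, hA, ?_⟩
  by_contra! hc
  obtain ⟨B, hB, hAB⟩ := hc
  obtain ⟨j, hj, u, v, hBj⟩ := exists_mem_allMinSeparators_of_mem_nestedBelow hB
  obtain ⟨C, hC, hBC, hCn⟩ := exists_corner_of_lt hcompl hsub hj hBj hA (fun h => hAB h.symm)
  have hlt : {X | X ∈ nestedBelow d k ∧ ¬ Nested C X}.ncard <
      {X | X ∈ nestedBelow d k ∧ ¬ Nested A X}.ncard := by
    refine ncard_lt_ncard ⟨?_, fun h => ?_⟩ (hfinite A hA)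
    · rintro X ⟨hX, hn⟩
      exact ⟨hX, fun h => hn (hCn X
        (nested_of_mem_nestedBelow hcompl hsub hfin k X hX B hB) h.symm).symm⟩
    · exact (h (show B ∈ {X | X ∈ nestedBelow d k ∧ ¬ Nested A X} from ⟨hB, hAB⟩)).2 hBC.symm
  exact absurd (hmin hC hlt.le) (not_le.2 hlt)

include hcompl hsub hfin in
/-- Any two ultrafilters separated by a set of finite value are separated by a set of minimum value
in `nestedSet d`. -/
theorem exists_mem_nestedSet {p q : Ultrafilter V} {A₀ : Set V} (h₀ : Sep A₀ p q)
    (hd : d A₀ ≠ ⊤) : ∃ A ∈ nestedSet d, Sep A p q ∧ ∀ B, Sep B p q → d A ≤ d B := by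
  obtain ⟨A₁, hA₁, hmin₁⟩ := exists_minimalFor_of_wellFoundedLT (fun A => Sep A p q) d ⟨A₀, h₀⟩
  have hle : ∀ B, Sep B p q → d A₁ ≤ d B := fun B hB => by
    rcases le_total (d A₁) (d B) with h | h
    · exact h
    · exact hmin₁ hB h
  obtain ⟨k, hk⟩ := ENat.ne_top_iff_exists.1 (ne_top_of_le_ne_top hd (hle A₀ h₀))
  have hne : (minSeparators d k p q).Nonempty := ⟨A₁, hA₁, hk.symm, fun B hB => hk ▸ hle B hB⟩
  obtain ⟨A, hA, hmin⟩ := exists_minimalFor_of_wellFoundedLT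
    (· ∈ admissible d k (nestedBelow d k) p q) (fun A => (crossing d k A).ncard)
    (admissible_nonempty hcompl hsub hfin hne)
  refine ⟨A, mem_iUnion.2 ⟨k + 1, Or.inr ⟨p, q, hA, fun B hB => ?_⟩⟩, hA.1.1, fun B hB => ?_⟩
  · rcases le_total (crossing d k A).ncard (crossing d k B).ncard with h | h
    · exact h
    · exact hmin hB h
  · rw [hA.1.2.1]
    exact hA.1.2.2 B hB

end NestedSet

/-! ### Invariance under bijections -/

section Equivariance

variable {V' : Type u} {d : Set V → ℕ∞} {d' : Set V' → ℕ∞} (e : V ≃ V')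
  (he : ∀ A, d' A = d (e ⁻¹' A))

theorem nested_preimage {A B : Set V'} : Nested (e ⁻¹' A) (e ⁻¹' B) ↔ Nested A B := by
  simp only [Nested, ← preimage_compl, e.surjective.preimage_subset_preimage_iff]

theorem sep_map {A : Set V'} {p q : Ultrafilter V} :
    Sep A (p.map e) (q.map e) ↔ Sep (e ⁻¹' A) p q := by
  simp only [Sep, Ultrafilter.mem_map]

theorem exists_ultrafilter_map (p : Ultrafilter V') : ∃ p₀ : Ultrafilter V, p₀.map e = p :=
  ⟨p.map e.symm, by rw [Ultrafilter.map_map, e.self_comp_symm, Ultrafilter.map_id]⟩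

include he in
theorem minSeparators_map {k : ℕ} {p q : Ultrafilter V} {A : Set V'} :
    A ∈ minSeparators d' k (p.map e) (q.map e) ↔ e ⁻¹' A ∈ minSeparators d k p q := by
  simp only [minSeparators, mem_ofPred_eq, sep_map, he]
  refine and_congr_right fun _ => and_congr_right fun _ => ⟨fun h B hB => ?_, fun h B => h _⟩
  have := h (e.symm ⁻¹' B)
  rw [e.preimage_symm_preimage] at this
  exact this hB

include he in
theorem allMinSeparators_map {k : ℕ} {A : Set V'} :
    A ∈ allMinSeparators d' k ↔ e ⁻¹' A ∈ allMinSeparators d k := by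
  constructor
  · rintro ⟨p, q, h⟩
    obtain ⟨p, rfl⟩ := exists_ultrafilter_map e p
    obtain ⟨q, rfl⟩ := exists_ultrafilter_map e q
    exact ⟨p, q, (minSeparators_map e he).1 h⟩
  · rintro ⟨p, q, h⟩
    exact ⟨p.map e, q.map e, (minSeparators_map e he).2 h⟩

include he in
theorem ncard_crossing_map {k : ℕ} {A : Set V'} :
    (crossing d' k A).ncard = (crossing d k (e ⁻¹' A)).ncard := by
  have : crossing d k (e ⁻¹' A) = (fun B : Set V' => e ⁻¹' B) '' crossing d' k A := by
    ext B
    obtain ⟨B, rfl⟩ := e.injective.preimage_surjective B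
    rw [e.surjective.preimage_injective.mem_set_image]
    simp only [crossing, mem_ofPred_eq, nested_preimage, allMinSeparators_map e he]
  rw [this, ncard_image_of_injective _ e.surjective.preimage_injective]

include he in
theorem admissible_map {k : ℕ} {S : Set (Set V)} {S' : Set (Set V')}
    (hS : ∀ A, A ∈ S' ↔ e ⁻¹' A ∈ S) {p q : Ultrafilter V} {A : Set V'} :
    A ∈ admissible d' k S' (p.map e) (q.map e) ↔ e ⁻¹' A ∈ admissible d k S p q := by
  simp only [admissible, mem_ofPred_eq, minSeparators_map e he, hS]
  refine and_congr_right fun _ => ⟨fun h B hB => ?_, fun h B hB => nested_preimage e |>.1 (h _ hB)⟩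
  obtain ⟨B, rfl⟩ := e.injective.preimage_surjective B
  exact (nested_preimage e).2 (h B hB)

include he in
theorem optimal_map {k : ℕ} {S : Set (Set V)} {S' : Set (Set V')}
    (hS : ∀ A, A ∈ S' ↔ e ⁻¹' A ∈ S) {A : Set V'} :
    A ∈ optimal d' k S' ↔ e ⁻¹' A ∈ optimal d k S := by
  have key : ∀ p q : Ultrafilter V,
      (A ∈ admissible d' k S' (p.map e) (q.map e) ∧ ∀ B ∈ admissible d' k S' (p.map e) (q.map e),
        (crossing d' k A).ncard ≤ (crossing d' k B).ncard) ↔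
      (e ⁻¹' A ∈ admissible d k S p q ∧ ∀ B ∈ admissible d k S p q,
        (crossing d k (e ⁻¹' A)).ncard ≤ (crossing d k B).ncard) := fun p q => by
    simp only [admissible_map e he hS, ncard_crossing_map e he]
    refine and_congr_right fun _ => ⟨fun h B hB => ?_, fun h B hB => h _ hB⟩
    obtain ⟨B, rfl⟩ := e.injective.preimage_surjective B
    exact h B hB
  constructor
  · rintro ⟨p, q, h⟩
    obtain ⟨p, rfl⟩ := exists_ultrafilter_map e p
    obtain ⟨q, rfl⟩ := exists_ultrafilter_map e q
    exact ⟨p, q, (key p q).1 h⟩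
  · rintro ⟨p, q, h⟩
    exact ⟨p.map e, q.map e, (key p q).2 h⟩

include he in
theorem nestedBelow_map (k : ℕ) :
    ∀ A : Set V', A ∈ nestedBelow d' k ↔ e ⁻¹' A ∈ nestedBelow d k := by
  induction k with
  | zero => exact fun A => Iff.rfl
  | succ k ih => exact fun A => or_congr (ih A) (optimal_map e he ih)

include he in
/-- The construction of `nestedSet` commutes with bijections. -/
theorem nestedSet_map {A : Set V'} : A ∈ nestedSet d' ↔ e ⁻¹' A ∈ nestedSet d := by
  simp only [nestedSet, mem_iUnion, nestedBelow_map e he]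

end Equivariance

end MinSeparator

namespace SimpleGraph

open Set MinSeparator

variable {V : Type u} {G : SimpleGraph V}

/-! ### Cuts -/

theorem mk_mem_cutEdges {A : Set V} {a b : V} :
    s(a, b) ∈ G.cutEdges A ↔ G.Adj a b ∧ ((a ∈ A ∧ b ∉ A) ∨ (b ∈ A ∧ a ∉ A)) := by
  constructor
  · rintro ⟨x, hx, y, hy, hxy, h⟩
    rcases Sym2.eq_iff.1 h with ⟨rfl, rfl⟩ | ⟨rfl, rfl⟩
    · exact ⟨hxy, Or.inl ⟨hx, hy⟩⟩
    · exact ⟨hxy.symm, Or.inr ⟨hx, hy⟩⟩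
  · rintro ⟨hab, ⟨ha, hb⟩ | ⟨hb, ha⟩⟩
    · exact ⟨a, ha, b, hb, hab, rfl⟩
    · exact ⟨b, hb, a, ha, hab.symm, Sym2.eq_swap⟩

theorem cutEdges_subset_edgeSet (A : Set V) : G.cutEdges A ⊆ G.edgeSet := by
  rintro _ ⟨a, -, b, -, h, rfl⟩
  exact h

theorem cutEdges_compl (A : Set V) : G.cutEdges Aᶜ = G.cutEdges A := by
  ext e
  induction e using Sym2.ind with
  | _ a b =>
    rw [mk_mem_cutEdges, mk_mem_cutEdges]
    simp only [mem_compl_iff, not_not]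
    tauto

/-- Both the union and the intersection of the two corner cuts lie in those of the original cuts.
Comparing them separately avoids subtraction, so infinite cuts need no special care. -/
theorem encard_cutEdges_submodular (A B : Set V) :
    (G.cutEdges (A ∩ B)).encard + (G.cutEdges (A ∪ B)).encard ≤
      (G.cutEdges A).encard + (G.cutEdges B).encard := by
  rw [← encard_union_add_encard_inter, ← encard_union_add_encard_inter (G.cutEdges A)]
  refine add_le_add (encard_le_encard ?_) (encard_le_encard ?_)
  · intro e
    induction e using Sym2.ind with
    | _ a b =>
      simp only [mem_union, mk_mem_cutEdges, mem_inter_iff]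
      tauto
  · intro e
    induction e using Sym2.ind with
    | _ a b =>
      simp only [mem_union, mk_mem_cutEdges, mem_inter_iff]
      tauto

theorem cutEdges_preimage {V' : Type u} {G' : SimpleGraph V'} (φ : G ≃g G') (A : Set V') :
    G'.cutEdges A = Sym2.map φ '' G.cutEdges (φ ⁻¹' A) := by
  ext e
  constructor
  · rintro ⟨a, ha, b, hb, hab, rfl⟩
    refine ⟨s(φ.symm a, φ.symm b), mk_mem_cutEdges.2 ⟨φ.symm.map_adj_iff.2 hab, Or.inl ?_⟩, ?_⟩
    · simpa using ⟨ha, hb⟩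
    · simp
  · rintro ⟨_, ⟨a, ha, b, hb, hab, rfl⟩, rfl⟩
    exact ⟨φ a, ha, φ b, hb, φ.map_adj_iff.2 hab, rfl⟩

theorem encard_cutEdges_preimage {V' : Type u} {G' : SimpleGraph V'} (φ : G ≃g G') (A : Set V') :
    (G'.cutEdges A).encard = (G.cutEdges (φ ⁻¹' A)).encard := by
  rw [cutEdges_preimage φ, (Sym2.map.injective φ.injective).encard_image]

theorem Connected.exists_adj_of_nonempty (hG : G.Connected) {A : Set V} (hA : A.Nonempty)
    (hA' : Aᶜ.Nonempty) : ∃ a ∈ A, ∃ b ∉ A, G.Adj a b := by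
  obtain ⟨a, ha⟩ := hA
  obtain ⟨b, hb⟩ := hA'
  obtain ⟨p⟩ := hG.preconnected a b
  obtain ⟨d, -, h₁, h₂⟩ := p.exists_boundary_dart A ha hb
  exact ⟨d.fst, h₁, d.snd, h₂, d.adj⟩

/-- A set of vertices inducing a connected subgraph that contains no edge of a cut lies on one side
of the cut. -/
theorem subset_or_subset_compl_of_preconnected {A B : Set V} (hB : (G.induce B).Preconnected)
    (h : ∀ a ∈ B, ∀ b ∈ B, G.Adj a b → a ∈ A → b ∈ A) : B ⊆ A ∨ B ⊆ Aᶜ := by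
  by_contra! hc
  obtain ⟨b, hb, hbA⟩ := not_subset.1 hc.1
  obtain ⟨a, ha, haA⟩ := not_subset.1 hc.2
  obtain ⟨p⟩ := hB ⟨a, ha⟩ ⟨b, hb⟩
  obtain ⟨d, -, h₁, h₂⟩ := p.exists_boundary_dart (Subtype.val ⁻¹' A) (not_not.1 haA) hbA
  exact h₂ (h _ d.fst.2 _ d.snd.2 d.adj h₁)

theorem induce_connected_of_forall_exists_adj {A : Set V} (hA : A.Nonempty)
    (h : ∀ B ⊆ A, B.Nonempty → (A \ B).Nonempty → ∃ a ∈ B, ∃ b ∈ A \ B, G.Adj a b) :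
    (G.induce A).Connected := by
  have : Nonempty A := hA.to_subtype
  refine ⟨fun x y => ?_⟩
  by_contra hxy
  obtain ⟨a, ⟨a, ha, rfl⟩, b, ⟨hbA, hb⟩, hab⟩ := h
    (Subtype.val '' {z | (G.induce A).Reachable x z}) (by rintro _ ⟨z, -, rfl⟩; exact z.2)
    ⟨x, x, Reachable.refl x, rfl⟩
    ⟨y, y.2, by rintro ⟨z, hz, hzy⟩; exact hxy (Subtype.ext hzy ▸ hz)⟩
  have hadj : (G.induce A).Adj a ⟨b, hbA⟩ := hab
  exact hb ⟨⟨b, hbA⟩, Reachable.trans ha hadj.reachable, rfl⟩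

/-- The endpoints of the edges in `F`. -/
def endpoints (F : Set (Sym2 V)) : Set V := {v | ∃ e ∈ F, v ∈ e}

theorem endpoints_finite {F : Set (Sym2 V)} (hF : F.Finite) : (endpoints F).Finite := by
  have : endpoints F = ⋃ e ∈ F, {v | v ∈ e} := by
    ext v
    simp [endpoints]
  rw [this]
  refine hF.biUnion fun e _ => ?_
  induction e using Sym2.ind with
  | _ a b =>
    refine (toFinite {a, b}).subset fun v hv => ?_
    simpa using hv

/-! ### Finiteness of the set of crossing bonds -/

/-- The sides containing `u` of the bonds with at most `k` edges that separate `u` from `v`. -/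
def bondSides (G : SimpleGraph V) (k : ℕ) (u v : V) : Set (Set V) :=
  {A | u ∈ A ∧ v ∉ A ∧ (G.induce A).Preconnected ∧ (G.induce Aᶜ).Preconnected ∧
    (G.cutEdges A).encard ≤ k}

theorem induce_deleteEdges_preconnected {A : Set V} {a b : V}
    (h : (G.induce A).Preconnected) (hab : a ∉ A ∨ b ∉ A) :
    ((G.deleteEdges {s(a, b)}).induce A).Preconnected := by
  convert h using 1
  ext x y
  simp only [comap_adj, deleteEdges_adj, mem_singleton_iff, Function.Embedding.subtype_apply]
  refine and_iff_left fun hxy => ?_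
  rcases Sym2.eq_iff.1 hxy with ⟨h₁, h₂⟩ | ⟨h₁, h₂⟩
  · exact hab.elim (fun h => h (h₁ ▸ x.2)) fun h => h (h₂ ▸ y.2)
  · exact hab.elim (fun h => h (h₂ ▸ y.2)) fun h => h (h₁ ▸ x.2)

/-- The only candidate is the component of `u`: a vertex of it outside `A` would link `u` to `v`
through the connected side `Aᶜ`. -/
theorem bondSides_finite_of_not_reachable {k : ℕ} {u v : V} (h : ¬ G.Reachable u v) :
    (G.bondSides k u v).Finite := by
  refine (finite_singleton {w | G.Reachable u w}).subset ?_
  rintro A ⟨hu, hv, hA, hA', -⟩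
  have hle : ∀ B : Set V, (G.induce B).Preconnected → ∀ x ∈ B, ∀ y ∈ B, G.Reachable x y :=
    fun B hB x hx y hy => (hB ⟨x, hx⟩ ⟨y, hy⟩).map (Embedding.induce B).toHom
  refine Set.ext fun w => ⟨fun hw => hle A hA u hu w hw, fun hw => ?_⟩
  by_contra hwA
  exact h (Reachable.trans hw (hle Aᶜ hA' w hwA v hv))

/-- Only finitely many bonds with at most `k` edges separate two given vertices. -/
theorem bondSides_finite (k : ℕ) :
    ∀ (G : SimpleGraph V) (u v : V), (G.bondSides k u v).Finite := by
  induction k with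
  | zero =>
    intro G u v
    by_cases h : G.Reachable u v
    · refine Set.finite_empty.subset ?_
      rintro A ⟨hu, hv, -, -, hk⟩
      obtain ⟨p⟩ := h
      obtain ⟨d, -, h₁, h₂⟩ := p.exists_boundary_dart A hu hv
      have hd : s(d.fst, d.snd) ∈ G.cutEdges A := mk_mem_cutEdges.2 ⟨d.adj, Or.inl ⟨h₁, h₂⟩⟩
      rw [Nat.cast_zero, nonpos_iff_eq_zero, encard_eq_zero] at hk
      exact (hk ▸ hd : _ ∈ (∅ : Set (Sym2 V)))
    · exact bondSides_finite_of_not_reachable h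
  | succ k ih =>
    intro G u v
    by_cases h : G.Reachable u v
    · obtain ⟨p⟩ := h
      -- Every such bond contains an edge of the fixed walk `p`. Deleting that edge lowers the size
      -- of the bond and keeps its sides connected; the graph itself may become disconnected, hence
      -- the induction over all graphs.
      refine ((p.darts.finite_toSet).biUnion fun d _ =>
        ih (G.deleteEdges {s(d.fst, d.snd)}) d.fst d.snd).subset ?_
      rintro A ⟨hu, hv, hA, hA', hk⟩
      obtain ⟨d, hd, h₁, h₂⟩ := p.exists_boundary_dart A hu hv
      refine mem_biUnion (show d ∈ {d | d ∈ p.darts} from hd) ⟨h₁, h₂,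
        induce_deleteEdges_preconnected hA (Or.inr h₂),
        induce_deleteEdges_preconnected hA' (Or.inl fun h => h h₁), ?_⟩
      have hmem : s(d.fst, d.snd) ∈ G.cutEdges A := mk_mem_cutEdges.2 ⟨d.adj, Or.inl ⟨h₁, h₂⟩⟩
      have hsub : (G.deleteEdges {s(d.fst, d.snd)}).cutEdges A ⊆
          G.cutEdges A \ {s(d.fst, d.snd)} := by
        rintro _ ⟨a, ha, b, hb, hab, rfl⟩
        rw [deleteEdges_adj] at hab
        exact ⟨⟨a, ha, b, hb, hab.1, rfl⟩, hab.2⟩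
      refine (encard_le_encard hsub).trans ?_
      rw [← encard_sdiff_singleton_add_one hmem, Nat.cast_succ] at hk
      exact (ENat.add_le_add_iff_right ENat.one_ne_top).1 hk
    · exact bondSides_finite_of_not_reachable h

/-! ### Minimum separators are bonds -/

/-- The size of the cut with side `A`. -/
noncomputable def cutSize (G : SimpleGraph V) (A : Set V) : ℕ∞ := (G.cutEdges A).encard

theorem cutSize_compl (A : Set V) : G.cutSize Aᶜ = G.cutSize A := by
  rw [cutSize, cutSize, cutEdges_compl]

/-- If `A` fell into two parts with no edges between them, the part belonging to `p` would still
separate `p` from `q`, but with a strictly smaller cut. -/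
theorem induce_connected_of_mem_minSeparators (hG : G.Connected) {k : ℕ} {p q : Ultrafilter V}
    {A : Set V} (hAp : A ∈ p) (hA : A ∈ minSeparators G.cutSize k p q) :
    (G.induce A).Connected := by
  have hAq : A ∉ q := fun h => hA.1 (iff_of_true hAp h)
  -- no part of `A` that has no edges to the rest of `A` separates `p` from `q`
  have key : ∀ B ⊆ A, (A \ B).Nonempty → (∀ a ∈ B, ∀ b ∈ A \ B, ¬ G.Adj a b) → B ∉ p := by
    intro B hB hne hno hBp
    have hBq : B ∉ q := fun h => hAq (Filter.mem_of_superset h hB)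
    have hBp' : Sep B p q := fun h => hBq (h.1 hBp)
    -- By connectedness some edge leaves `A \ B`. It cannot end in `B`, so it lies in the cut of `A`
    -- but not in that of `B`.
    obtain ⟨a, ha, b, hb, hab⟩ := hG.exists_adj_of_nonempty hne
      ((Ultrafilter.nonempty_of_mem hBp).mono fun x hx h => h.2 hx)
    have hbB : b ∉ B := fun h => hno b h a ha hab.symm
    have hbA : b ∉ A := fun h => hb ⟨h, hbB⟩
    have hssub : G.cutEdges B ⊂ G.cutEdges A := by
      refine ⟨?_, fun h => ?_⟩
      · rintro _ ⟨x, hx, y, hy, hxy, rfl⟩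
        exact ⟨x, hB hx, y, fun hyA => hno x hx y ⟨hyA, hy⟩ hxy, hxy, rfl⟩
      · have := (mk_mem_cutEdges.1 (h (mk_mem_cutEdges.2 ⟨hab, Or.inl ⟨ha.1, hbA⟩⟩))).2
        exact this.elim (fun h => ha.2 h.1) fun h => hbB h.1
    have hfin : (G.cutEdges A).Finite := by
      rw [← encard_ne_top_iff]
      exact ne_of_eq_of_ne hA.2.1 (ENat.natCast_ne_top k)
    have hlt := (hfin.subset hssub.1).encard_lt_encard hssub
    exact absurd ((hA.2.2 B hBp').trans_lt hlt) (by rw [← hA.2.1]; exact lt_irrefl _)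
  refine induce_connected_of_forall_exists_adj (Ultrafilter.nonempty_of_mem hAp)
    fun B hB hBne hne => ?_
  by_contra! hno
  rw [← union_sdiff_cancel hB, Ultrafilter.union_mem_iff] at hAp
  rcases hAp with h | h
  · exact key B hB hne hno h
  · have e : A \ (A \ B) = B := by rw [sdiff_sdiff_cancel_left hB]
    refine key (A \ B) sdiff_subset (by rwa [e]) (fun a ha b hb hab => ?_) h
    rw [e] at hb
    exact hno b hb a ha hab.symm

theorem connected_of_mem_allMinSeparators (hG : G.Connected) {k : ℕ} {A : Set V}
    (hA : A ∈ allMinSeparators G.cutSize k) : (G.induce A).Connected := by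
  obtain ⟨p, q, h⟩ := hA
  by_cases hp : A ∈ p
  · exact induce_connected_of_mem_minSeparators hG hp h
  · have hq : A ∈ q := by
      by_contra hq
      exact h.1 (iff_of_false hp hq)
    exact induce_connected_of_mem_minSeparators hG (q := p) hq
      ⟨fun e => h.1 e.symm, h.2.1, fun B hB => h.2.2 B fun e => hB e.symm⟩

/-- A connected side of a crossing bond that avoided all endpoints of the cut of `A` would lie
within `A` or `Aᶜ`. So both sides contain such endpoints, and there are only finitely many pairs of
them. -/
theorem crossing_finite (hG : G.Connected) (j k : ℕ) (A : Set V)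
    (hA : A ∈ allMinSeparators G.cutSize j) : (crossing G.cutSize k A).Finite := by
  obtain ⟨p, q, hApq⟩ := hA
  have hfin : (G.cutEdges A).Finite := by
    rw [← encard_ne_top_iff]
    exact ne_of_eq_of_ne hApq.2.1 (ENat.natCast_ne_top j)
  have hT := endpoints_finite hfin
  refine (hT.biUnion fun u _ => hT.biUnion fun v _ => bondSides_finite k G u v).subset ?_
  rintro B ⟨hB, hAB⟩
  have hBconn := connected_of_mem_allMinSeparators hG hB
  have hBconn' := connected_of_mem_allMinSeparators hG (allMinSeparators_compl cutSize_compl hB)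
  have meets : ∀ C : Set V, (G.induce C).Connected → ¬ Nested A C →
      ∃ u ∈ endpoints (G.cutEdges A), u ∈ C := by
    intro C hC hAC
    by_contra! hc
    refine hAC (Nested.symm ?_)
    rcases subset_or_subset_compl_of_preconnected (A := A) hC.preconnected
      (fun a ha b hb hab haA => by
        by_contra hbA
        exact hc a ⟨s(a, b), mk_mem_cutEdges.2 ⟨hab, Or.inl ⟨haA, hbA⟩⟩, by simp⟩ ha) with h | h
    · exact Or.inl h
    · exact Or.inr (Or.inl h)
  obtain ⟨u, hu, huB⟩ := meets B hBconn hAB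
  obtain ⟨v, hv, hvB⟩ := meets Bᶜ hBconn' (by rwa [nested_compl_right])
  obtain ⟨p', q', hB'⟩ := hB
  exact mem_biUnion hu (mem_biUnion hv
    ⟨huB, hvB, hBconn.preconnected, hBconn'.preconnected, hB'.2.1.le⟩)

/-! ### Vertices and ends as ultrafilters -/

/-- The principal ultrafilter of a vertex, or an ultrafilter containing all tails of some ray of an
end. -/
noncomputable def pointUltrafilter : G.Point → Ultrafilter V
  | Sum.inl v => pure v
  | Sum.inr ω => (Filter.hyperfilter ℕ).map (Quotient.out ω).vert

theorem mem_map_hyperfilter_of_forall_ge {f : ℕ → V} {A : Set V} {n : ℕ}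
    (h : ∀ m, n ≤ m → f m ∈ A) : A ∈ (Filter.hyperfilter ℕ).map f := by
  rw [Ultrafilter.mem_map]
  refine Filter.mem_hyperfilter_of_finite_compl ((finite_Iio n).subset fun m hm => ?_)
  by_contra hc
  exact hm (h m (not_lt.1 hc))

theorem LivesIn.mono {X Y : Set G.Point} {H : SimpleGraph V} {C : H.ConnectedComponent}
    (h : G.LivesIn Y C) (hXY : X ⊆ Y) : G.LivesIn X C :=
  ⟨fun v hv => h.1 v (hXY hv), fun R hR => h.2 R (hXY hR)⟩

theorem LivesIn.supp_mem_pointUltrafilter {x : G.Point} {H : SimpleGraph V}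
    {C : H.ConnectedComponent} (h : G.LivesIn {x} C) : C.supp ∈ pointUltrafilter x := by
  rcases x with v | ω
  · exact h.1 v rfl
  · obtain ⟨n, hn⟩ := h.2 (Quotient.out ω) (congrArg Sum.inr (Quotient.out_eq ω))
    exact mem_map_hyperfilter_of_forall_ge fun m hm => (hn m hm).1

theorem cutEdges_supp_subset {F : Set (Sym2 V)} (C : (G.deleteEdges F).ConnectedComponent) :
    G.cutEdges C.supp ⊆ F := by
  rintro _ ⟨a, ha, b, hb, hab, rfl⟩
  by_contra hF
  exact hb ((C.mem_supp_congr_adj ((deleteEdges_adj).2 ⟨hab, hF⟩)).1 ha)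

/-- An edge set distinguishing two points contains a cut that separates their ultrafilters. -/
theorem Distinguishes.exists_sep {F : Set (Sym2 V)} {x y : G.Point}
    (h : G.Distinguishes F {x} {y}) :
    ∃ A, Sep A (pointUltrafilter x) (pointUltrafilter y) ∧ G.cutSize A ≤ F.encard := by
  obtain ⟨-, C, D, hCD, hC, hD⟩ := h
  refine ⟨C.supp, fun e => ?_, encard_le_encard (cutEdges_supp_subset C)⟩
  obtain ⟨v, hvC, hvD⟩ := Ultrafilter.nonempty_of_mem
    (inter_mem_ultrafilter.2 ⟨e.1 hC.supp_mem_pointUltrafilter, hD.supp_mem_pointUltrafilter⟩)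
  exact hCD (hvC.symm.trans hvD)

theorem inseparable_refl (k : ℕ∞) (x : G.Point) : G.Inseparable k x x := by
  rintro ⟨F, -, hF⟩
  obtain ⟨A, hA, -⟩ := hF.exists_sep
  exact hA Iff.rfl

/-- A component meeting both sides would contain an edge of the cut, whose endpoints have been
removed. -/
theorem componentCompl_subset {A : Set V} (C : G.ComponentCompl (endpoints (G.cutEdges A))) :
    (C : Set V) ⊆ A ∨ (C : Set V) ⊆ Aᶜ := by
  by_contra! hc
  obtain ⟨b, ⟨hbS, hb⟩, hbA⟩ := not_subset.1 hc.1
  obtain ⟨a, ⟨haS, ha⟩, haA⟩ := not_subset.1 hc.2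
  obtain ⟨p⟩ := ConnectedComponent.exact (ha.trans hb.symm)
  obtain ⟨d, -, h₁, h₂⟩ := p.exists_boundary_dart (Subtype.val ⁻¹' A) (not_not.1 haA) hbA
  exact d.fst.2 ⟨s(d.fst.1, d.snd.1), mk_mem_cutEdges.2 ⟨d.adj, Or.inl ⟨h₁, h₂⟩⟩, by simp⟩

/-- A point whose ultrafilter contains the connected side `A` of a finite cut lives in the
component with vertex set `A`. -/
theorem livesIn_of_mem_pointUltrafilter {A : Set V} (hfin : (G.cutEdges A).Finite)
    {C : (G.deleteEdges (G.cutEdges A)).ConnectedComponent} (hAC : A ⊆ C.supp) {X : Set G.Point}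
    (hX : ∀ x ∈ X, A ∈ pointUltrafilter x) : G.LivesIn X C := by
  refine ⟨fun v hv => hAC (hX _ hv), fun R hR => ?_⟩
  have hA := hX _ hR
  -- The ultrafilter knows only the chosen representative of the end. Equivalence puts tails of it
  -- and of `R` into one component off the finitely many cut endpoints, hence on one side of the
  -- cut.
  obtain ⟨D, hout, n, hn⟩ := Quotient.mk_out (s := Ray.setoid G) R _ (endpoints_finite hfin)
  have hDA : (D : Set V) ⊆ A := by
    rcases componentCompl_subset D with h | h
    · exact h
    · obtain ⟨m, hm⟩ := hout
      exact absurd hA (Ultrafilter.compl_mem_iff_notMem.1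
        (mem_map_hyperfilter_of_forall_ge fun i hi => h (hm i hi)))
  refine ⟨n, fun m hm => ⟨hAC (hDA (hn m hm)), deleteEdges_adj.2 ⟨R.adj m, fun h => ?_⟩⟩⟩
  have h₁ : R.vert m ∈ A := hDA (hn m hm)
  have h₂ : R.vert (m + 1) ∈ A := hDA (hn (m + 1) (by omega))
  have := (mk_mem_cutEdges.1 h).2
  tauto

theorem exists_component_of_induce_connected {A : Set V} (hA : (G.induce A).Connected) :
    ∃ C : (G.deleteEdges (G.cutEdges A)).ConnectedComponent, C.supp = A := by
  obtain ⟨⟨a, ha⟩⟩ := hA.nonempty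
  refine ⟨connectedComponentMk _ a, Set.ext fun v => ⟨fun hv => ?_, fun hv => ?_⟩⟩
  · by_contra hvA
    obtain ⟨p⟩ := ConnectedComponent.exact hv.symm
    obtain ⟨d, -, h₁, h₂⟩ := p.exists_boundary_dart A ha hvA
    have := deleteEdges_adj.1 d.adj
    exact this.2 (mk_mem_cutEdges.2 ⟨this.1, Or.inl ⟨h₁, h₂⟩⟩)
  · refine ConnectedComponent.sound ?_
    have hle : G.induce A ≤ (G.deleteEdges (G.cutEdges A)).induce A := by
      intro x y hxy
      refine deleteEdges_adj.2 ⟨hxy, fun h => ?_⟩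
      have h₁ : x.1 ∈ A := x.2
      have h₂ : y.1 ∈ A := y.2
      have := (mk_mem_cutEdges.1 h).2
      tauto
    exact ((hA.preconnected ⟨v, hv⟩ ⟨a, ha⟩).mono hle).map (Embedding.induce A).toHom

/-- A finite bond distinguishes any two sets of points that it separates as sets of
ultrafilters. -/
theorem distinguishes_cutEdges {A : Set V} (hA : (G.induce A).Connected)
    (hA' : (G.induce Aᶜ).Connected) (hfin : (G.cutEdges A).Finite) {X Y : Set G.Point}
    (hX : ∀ x ∈ X, A ∈ pointUltrafilter x) (hY : ∀ y ∈ Y, A ∉ pointUltrafilter y) :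
    G.Distinguishes (G.cutEdges A) X Y := by
  refine ⟨cutEdges_subset_edgeSet A, ?_⟩
  obtain ⟨C, hC⟩ := exists_component_of_induce_connected hA
  have hD := exists_component_of_induce_connected hA'
  -- Abstracting over `D` lets the rewriting of the cut of `Aᶜ` to that of `A` change the type of
  -- `D` as well.
  have hYD := fun D => livesIn_of_mem_pointUltrafilter (A := Aᶜ) (by rwa [cutEdges_compl]) (C := D)
    (X := Y)
  rw [cutEdges_compl] at hD hYD
  obtain ⟨D, hD⟩ := hD
  refine ⟨C, D, fun h => ?_, livesIn_of_mem_pointUltrafilter hfin hC.ge hX,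
    hYD D hD.ge fun y hy => Ultrafilter.compl_mem_iff_notMem.2 (hY y hy)⟩
  obtain ⟨⟨a, ha⟩⟩ := hA.nonempty
  have : a ∈ Aᶜ := by rw [← hD, ← h, hC]; exact ha
  exact this ha

theorem Distinguishes.symm {F : Set (Sym2 V)} {X Y : Set G.Point} (h : G.Distinguishes F X Y) :
    G.Distinguishes F Y X := by
  obtain ⟨hF, C, D, hCD, hC, hD⟩ := h
  exact ⟨hF, D, C, hCD.symm, hD, hC⟩

theorem EfficientlyDistinguishes.symm {F : Set (Sym2 V)} {X Y : Set G.Point}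
    (h : G.EfficientlyDistinguishes F X Y) : G.EfficientlyDistinguishes F Y X :=
  ⟨h.1.symm, fun F' hF' => h.2 F' hF'.symm⟩

/-! ### The canonical nested set of bonds -/

/-- The canonical nested set of bonds of `G`. -/
def canonicalBonds (G : SimpleGraph V) : Set (Set (Sym2 V)) :=
  G.cutEdges '' nestedSet G.cutSize

theorem connected_sides_of_mem_nestedSet (hG : G.Connected) {A : Set V}
    (hA : A ∈ nestedSet G.cutSize) : (G.induce A).Connected ∧ (G.induce Aᶜ).Connected := by
  obtain ⟨k, hk⟩ := exists_mem_allMinSeparators_of_mem_nestedSet hA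
  exact ⟨connected_of_mem_allMinSeparators hG hk,
    connected_of_mem_allMinSeparators hG (allMinSeparators_compl cutSize_compl hk)⟩

theorem isSide_of_induce_connected {A : Set V} (hA : (G.induce A).Connected)
    (hA' : (G.induce Aᶜ).Connected) : G.IsSide (G.cutEdges A) A :=
  ⟨nonempty_coe_sort.1 hA.nonempty, nonempty_coe_sort.1 hA'.nonempty, rfl⟩

theorem IsSide.compl {F : Set (Sym2 V)} {A : Set V} (h : G.IsSide F A) : G.IsSide F Aᶜ :=
  ⟨h.2.1, by rw [compl_compl]; exact h.1, by rw [cutEdges_compl]; exact h.2.2⟩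

theorem nestedCuts_of_nested {F₁ F₂ : Set (Sym2 V)} {A B : Set V} (hA : G.IsSide F₁ A)
    (hB : G.IsSide F₂ B) (h : Nested A B) : G.NestedCuts F₁ F₂ := by
  rcases h with h | h | h | h
  · exact ⟨A, B, hA, hB, h⟩
  · exact ⟨A, Bᶜ, hA, hB.compl, h⟩
  · exact ⟨Aᶜ, B, hA.compl, hB, h⟩
  · exact ⟨Aᶜ, Bᶜ, hA.compl, hB.compl, h⟩

theorem isBond_of_mem_canonicalBonds (hG : G.Connected) {F : Set (Sym2 V)}
    (hF : F ∈ G.canonicalBonds) : G.IsBond F := by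
  obtain ⟨A, hA, rfl⟩ := hF
  have h := connected_sides_of_mem_nestedSet hG hA
  exact ⟨A, isSide_of_induce_connected h.1 h.2, h.1, h.2⟩

theorem nestedCuts_of_mem_canonicalBonds (hG : G.Connected) {F₁ F₂ : Set (Sym2 V)}
    (h₁ : F₁ ∈ G.canonicalBonds) (h₂ : F₂ ∈ G.canonicalBonds) : G.NestedCuts F₁ F₂ := by
  obtain ⟨A, hA, rfl⟩ := h₁
  obtain ⟨B, hB, rfl⟩ := h₂
  have hA' := connected_sides_of_mem_nestedSet hG hA
  have hB' := connected_sides_of_mem_nestedSet hG hB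
  exact nestedCuts_of_nested (isSide_of_induce_connected hA'.1 hA'.2)
    (isSide_of_induce_connected hB'.1 hB'.2) (nested_of_mem_nestedSet cutSize_compl
      encard_cutEdges_submodular (crossing_finite hG) hA hB)

/-- If `y` is separated from `x` by fewer than `k` edges, then some canonical bond efficiently
distinguishes the `k`-edge-block of `x` from the `l`-edge-block of `y`, for `k ≤ l`. -/
theorem exists_canonicalBond (hG : G.Connected) {k l : ℕ∞} (hkl : k ≤ l) {x y : G.Point}
    (hxy : ¬ G.Inseparable k x y) :
    ∃ F ∈ G.canonicalBonds,
      G.EfficientlyDistinguishes F {z | G.Inseparable k x z} {z | G.Inseparable l y z} := by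
  obtain ⟨F, hFk, hF⟩ := not_not.1 hxy
  obtain ⟨A₀, hA₀, hle⟩ := hF.exists_sep
  obtain ⟨A, hAN, hA, hmin⟩ := exists_mem_nestedSet cutSize_compl encard_cutEdges_submodular
    (crossing_finite hG) hA₀ (hle.trans_lt (hFk.trans_le le_top)).ne
  have hlt : (G.cutEdges A).encard < k := ((hmin A₀ hA₀).trans hle).trans_lt hFk
  have hfin : (G.cutEdges A).Finite := encard_lt_top_iff.1 (hlt.trans_le le_top)
  have hconn := connected_sides_of_mem_nestedSet hG hAN
  have hdist : ∀ {z w : G.Point}, Sep A (pointUltrafilter z) (pointUltrafilter w) →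
      G.Distinguishes (G.cutEdges A) {z} {w} := by
    intro z w h
    by_cases hz : A ∈ pointUltrafilter z
    · exact distinguishes_cutEdges hconn.1 hconn.2 hfin (by rintro _ rfl; exact hz)
        (by rintro _ rfl; exact fun hw => h (iff_of_true hz hw))
    · refine (distinguishes_cutEdges hconn.1 hconn.2 hfin ?_ (by rintro _ rfl; exact hz)).symm
      rintro _ rfl
      by_contra hw
      exact h (iff_of_false hz hw)
  -- A cut with fewer than `k ≤ l` edges splits neither block, so every member is on the side of its
  -- representative.
  have hX : ∀ z, G.Inseparable k x z → (A ∈ pointUltrafilter x ↔ A ∈ pointUltrafilter z) :=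
    fun z hz => by_contra fun h => hz ⟨_, hlt, hdist h⟩
  have hY : ∀ z, G.Inseparable l y z → (A ∈ pointUltrafilter y ↔ A ∈ pointUltrafilter z) :=
    fun z hz => by_contra fun h => hz ⟨_, hlt.trans_le hkl, hdist h⟩
  refine ⟨G.cutEdges A, ⟨A, hAN, rfl⟩, ?_, ?_⟩
  · by_cases hx : A ∈ pointUltrafilter x
    · exact distinguishes_cutEdges hconn.1 hconn.2 hfin (fun z hz => (hX z hz).1 hx)
        fun z hz h => hA (iff_of_true hx ((hY z hz).2 h))
    · refine (distinguishes_cutEdges hconn.1 hconn.2 hfin (fun z hz => (hY z hz).1 ?_)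
        fun z hz h => hx ((hX z hz).2 h)).symm
      by_contra hy
      exact hA (iff_of_false hx hy)
  · rintro F' ⟨hF', C, D, hCD, hC, hD⟩
    have h' : G.Distinguishes F' {x} {y} := ⟨hF', C, D, hCD,
      hC.mono (singleton_subset_iff.2 (inseparable_refl k x)),
      hD.mono (singleton_subset_iff.2 (inseparable_refl l y))⟩
    obtain ⟨B, hB, hBF⟩ := h'.exists_sep
    exact (hmin B hB).trans hBF

/-- The block with the smaller index decides: the other representative lies outside it, so fewer
edges than that index separate the two representatives. -/
theorem exists_canonicalBond_of_disjoint (hG : G.Connected) {X Y : Set G.Point}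
    (hX : G.IsEdgeBlock X) (hY : G.IsEdgeBlock Y) (hXY : Disjoint X Y) :
    ∃ F ∈ G.canonicalBonds, G.EfficientlyDistinguishes F X Y := by
  obtain ⟨k, x, rfl⟩ := hX
  obtain ⟨l, y, rfl⟩ := hY
  rcases le_total k l with hkl | hkl
  · exact exists_canonicalBond hG hkl fun h =>
      Set.disjoint_left.1 hXY h (inseparable_refl l y)
  · obtain ⟨F, hF, h⟩ := exists_canonicalBond hG hkl (x := y) (y := x) fun h =>
      Set.disjoint_left.1 hXY (inseparable_refl k x) h
    exact ⟨F, hF, h.symm⟩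

theorem canonicalBonds_map {V' : Type u} {G' : SimpleGraph V'} (φ : G ≃g G') :
    G'.canonicalBonds = (fun F : Set (Sym2 V) => Sym2.map φ '' F) '' G.canonicalBonds := by
  have hmap : ∀ A, A ∈ nestedSet G'.cutSize ↔ φ ⁻¹' A ∈ nestedSet G.cutSize :=
    fun A => nestedSet_map φ.toEquiv (encard_cutEdges_preimage φ)
  ext F
  constructor
  · rintro ⟨A, hA, rfl⟩
    exact ⟨_, ⟨_, (hmap A).1 hA, rfl⟩, (cutEdges_preimage φ A).symm⟩
  · rintro ⟨_, ⟨A, hA, rfl⟩, rfl⟩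
    obtain ⟨A, rfl⟩ := φ.injective.preimage_surjective A
    exact ⟨A, (hmap A).2 hA, cutEdges_preimage φ A⟩

end SimpleGraph

/-! ### The main theorem -/

theorem theorem1 :
    ∃ N : (V : Type u) → SimpleGraph V → Set (Set (Sym2 V)),
      (∀ (V : Type u) (G : SimpleGraph V), G.Connected →
        (∀ F ∈ N V G, G.IsBond F) ∧
        (∀ F₁ ∈ N V G, ∀ F₂ ∈ N V G, G.NestedCuts F₁ F₂) ∧
        (∀ X Y : Set G.Point, G.IsEdgeBlock X → G.IsEdgeBlock Y → Disjoint X Y →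
          ∃ F ∈ N V G, G.EfficientlyDistinguishes F X Y)) ∧
      (∀ (V V' : Type u) (G : SimpleGraph V) (G' : SimpleGraph V') (φ : G ≃g G'),
        G.Connected →
          N V' G' = (fun F : Set (Sym2 V) => Sym2.map φ '' F) '' N V G) := by
  refine ⟨fun _ G => G.canonicalBonds, fun V G hG => ⟨?_, ?_, ?_⟩, fun V V' G G' φ _ => ?_⟩
  · exact fun F hF => SimpleGraph.isBond_of_mem_canonicalBonds hG hF
  · exact fun F₁ h₁ F₂ h₂ => SimpleGraph.nestedCuts_of_mem_canonicalBonds hG h₁ h₂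
  · exact fun X Y hX hY hXY => SimpleGraph.exists_canonicalBond_of_disjoint hG hX hY hXY
  · exact SimpleGraph.canonicalBonds_map φ
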